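/- Let $R$ be an associative ring with unit. An $\mathcal R$-module is a covariant additive functor $\mathbb M$ from left $R$-modules to abelian groups; morphisms are natural transformations, and kernels, products, direct limits, monomorphisms and epimorphisms are taken pointwise. A right $R$-module $N$ defines the quasi-coherent $\mathcal R$-module $\mathcal N(S)=N\otimes_R S$. The dual of $\mathbb M$ is the functor on right $R$-modules $\mathbb M^*(N)=\operatorname{Hom}_{\mathcal R}(\mathbb M,\mathcal N)$; a morphism $f\colon\mathbb F\to\mathbb M$ induces the dual morphism $f^*\colon\mathbb M^*\to\mathbb F^*$, $w\mapsto w\circ f$. Suppose that $\mathbb M$ preserves direct limits (colimits of direct systems indexed by upward directed sets). Call $\mathbb M$ an FP module if, for every family $\{S_i\}_{i\in I}$ of $R$-modules indexed by a set, the natural map $\mathbb M(\prod_i S_i)\to\prod_i\mathbb M(S_i)$ is bijective, and an ML module if this map is always injective. Call $\mathbb M$ an SML module if it is an ML module and, for every FP submodule $\mathbb F\subseteq\mathbb M$ (that is, subfunctor $\mathbb F$ which preserves direct limits and direct products), the dual morphism $\mathbb M^*\to\mathbb F^*$ is an epimorphism. Theorem. Let $\mathbb M$ be an $\mathcal R$-module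 that preserves direct limits. The following statements are equivalent: 1. $\mathbb M$ is an SML module. 2. There is a direct system $\{\mathbb F_i\}_{i\in I}$ of FP submodules of $\mathbb M$, indexed by an upward directed set, such that $\mathbb M=\varinjlim_{i\in I}\mathbb F_i$ and the dual morphism $\mathbb M^*\to\mathbb F_i^*$ is an epimorphism for every $i\in I$. 3. There exist a family $\{P_j\}_{j\in J}$ of finitely presented right $R$-modules, indexed by a set, and a monomorphism $\mathbb M\to\prod_{j\in J}\mathcal P_j$. -/

import Mathlib

universe u

open CategoryTheory CategoryTheory.Limits Opposite
open scoped TensorProduct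

namespace FunctorialModules

noncomputable section

/-! Throughout, `R` is an associative ring with unit, left `R`-modules are the objects of
`ModuleCat R`, and right `R`-modules are the objects of `ModuleCat Rᵐᵒᵖ`
(with `n · r = MulOpposite.op r • n`). -/

section Tensor

variable (R : Type u) [Ring R]

/-- The relations `(n · r) ⊗ s = n ⊗ (r · s)` inside `N ⊗_ℤ S`, for a right `R`-module `N` and a
left `R`-module `S`. -/
def balancedRel (N S : Type u) [AddCommGroup N] [Module Rᵐᵒᵖ N] [AddCommGroup S] [Module R S] :
    AddSubgroup (N ⊗[ℤ] S) :=
  AddSubgroup.closure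
    {t | ∃ (n : N) (r : R) (s : S), t = (MulOpposite.op r • n) ⊗ₜ[ℤ] s - n ⊗ₜ[ℤ] (r • s)}

/-- The tensor product `N ⊗_R S` of a right module and a left module over a ring that need not be
commutative; it is an abelian group. -/
abbrev BalancedTensor (N S : Type u) [AddCommGroup N] [Module Rᵐᵒᵖ N] [AddCommGroup S]
    [Module R S] : Type u :=
  (N ⊗[ℤ] S) ⧸ balancedRel R N S

variable {R}

/-- The homomorphism `n ⊗ s ↦ f n ⊗ g s`. -/
def BalancedTensor.map {N N' S S' : Type u} [AddCommGroup N] [Module Rᵐᵒᵖ N]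
    [AddCommGroup N'] [Module Rᵐᵒᵖ N'] [AddCommGroup S] [Module R S] [AddCommGroup S']
    [Module R S'] (f : N →ₗ[Rᵐᵒᵖ] N') (g : S →ₗ[R] S') :
    BalancedTensor R N S →+ BalancedTensor R N' S' :=
  QuotientAddGroup.map _ _
    (TensorProduct.map f.toAddMonoidHom.toIntLinearMap g.toAddMonoidHom.toIntLinearMap).toAddMonoidHom
    (by
      rw [balancedRel, AddSubgroup.closure_le]
      rintro _ ⟨n, r, s, rfl⟩
      refine AddSubgroup.subset_closure ⟨f n, r, g s, ?_⟩
      simp)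

theorem BalancedTensor.hom_ext {N S : Type u} [AddCommGroup N] [Module Rᵐᵒᵖ N] [AddCommGroup S]
    [Module R S] {A : Type*} [AddCommGroup A] {φ ψ : BalancedTensor R N S →+ A}
    (h : ∀ (n : N) (s : S), φ (QuotientAddGroup.mk (n ⊗ₜ[ℤ] s)) =
      ψ (QuotientAddGroup.mk (n ⊗ₜ[ℤ] s))) : φ = ψ := by
  refine QuotientAddGroup.addMonoidHom_ext _ ?_
  ext t
  induction t using TensorProduct.induction_on with
  | zero => simp
  | tmul n s => exact h n s
  | add x y hx hy => rw [map_add, map_add, hx, hy]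

theorem BalancedTensor.map_mk {N N' S S' : Type u} [AddCommGroup N] [Module Rᵐᵒᵖ N]
    [AddCommGroup N'] [Module Rᵐᵒᵖ N'] [AddCommGroup S] [Module R S] [AddCommGroup S']
    [Module R S'] (f : N →ₗ[Rᵐᵒᵖ] N') (g : S →ₗ[R] S') (n : N) (s : S) :
    BalancedTensor.map f g (QuotientAddGroup.mk (n ⊗ₜ[ℤ] s)) =
      QuotientAddGroup.mk (f n ⊗ₜ[ℤ] g s) := rfl

end Tensor

variable (R : Type u) [Ring R]

/-- The functor `N ↦ (S ↦ N ⊗_R S)` which sends a right `R`-module `N` to the quasi-coherent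
functor associated with it. -/
def quasiCoherent : ModuleCat.{u} Rᵐᵒᵖ ⥤ ModuleCat.{u} R ⥤ AddCommGrpCat.{u} where
  obj N :=
    { obj S := AddCommGrpCat.of (BalancedTensor R N S)
      map g := AddCommGrpCat.ofHom (BalancedTensor.map LinearMap.id g.hom)
      map_id S := by
        ext1
        exact BalancedTensor.hom_ext fun _ _ => rfl
      map_comp g g' := by
        ext1
        exact BalancedTensor.hom_ext fun _ _ => rfl }
  map f :=
    { app S := AddCommGrpCat.ofHom (BalancedTensor.map f.hom LinearMap.id)
      naturality S S' g := by
        ext1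
        exact BalancedTensor.hom_ext fun _ _ => rfl }
  map_id N := by
    ext S : 2
    ext1
    exact BalancedTensor.hom_ext fun _ _ => rfl
  map_comp f f' := by
    ext S : 2
    ext1
    exact BalancedTensor.hom_ext fun _ _ => rfl

variable {R}

/-- The dual `M*` of a functor `M` on left `R`-modules: the functor
`N ↦ Hom(M, N ⊗_R -)` on right `R`-modules, with the pointwise addition of natural
transformations. -/
def dual (M : ModuleCat.{u} R ⥤ AddCommGrpCat.{u}) :
    ModuleCat.{u} Rᵐᵒᵖ ⥤ AddCommGrpCat.{u + 1} :=
  quasiCoherent R ⋙ preadditiveCoyoneda.obj (op M)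

/-- The dual morphism `f* : M* ⟶ F*`, `w ↦ w ∘ f`, of a morphism `f : F ⟶ M`. -/
def dualMap {F M : ModuleCat.{u} R ⥤ AddCommGrpCat.{u}} (f : F ⟶ M) : dual M ⟶ dual F :=
  Functor.whiskerLeft (quasiCoherent R) (preadditiveCoyoneda.map f.op)

/-- `M` preserves direct limits, i.e. colimits of direct systems indexed by upward directed
sets. -/
def PreservesDirectLimits (M : ModuleCat.{u} R ⥤ AddCommGrpCat.{u}) : Prop :=
  ∀ (I : Type u) [Preorder I] [IsDirectedOrder I] [Nonempty I], PreservesColimitsOfShape I M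

/-- The natural map `M (∏ i, S i) → ∏ i, M (S i)`. -/
def toProd (M : ModuleCat.{u} R ⥤ AddCommGrpCat.{u}) {I : Type u} (S : I → ModuleCat.{u} R)
    (x : M.obj (ModuleCat.of R (∀ i, S i))) (i : I) : M.obj (S i) :=
  M.map (ModuleCat.ofHom (LinearMap.proj i : (∀ i, S i) →ₗ[R] S i)) x

/-- FP functors: additive, preserving direct limits and direct products. -/
structure IsFP (F : ModuleCat.{u} R ⥤ AddCommGrpCat.{u}) : Prop where
  additive : F.Additive
  preservesDirectLimits : PreservesDirectLimits F
  bijective_toProd : ∀ {I : Type u} (S : I → ModuleCat.{u} R), Function.Bijective (toProd F S)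

/-- ML functors. -/
structure IsML (M : ModuleCat.{u} R ⥤ AddCommGrpCat.{u}) : Prop where
  additive : M.Additive
  preservesDirectLimits : PreservesDirectLimits M
  injective_toProd : ∀ {I : Type u} (S : I → ModuleCat.{u} R), Function.Injective (toProd M S)

/-- SML functors: ML functors `M` such that `M* ⟶ F*` is an epimorphism for every FP
subfunctor `F` of `M`. -/
structure IsSML (M : ModuleCat.{u} R ⥤ AddCommGrpCat.{u}) : Prop where
  isML : IsML M
  epi_dualMap : ∀ (F : ModuleCat.{u} R ⥤ AddCommGrpCat.{u}) (i : F ⟶ M),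
    Mono i → IsFP F → Epi (dualMap i)

/-- `M` is the direct limit of a direct system of FP subfunctors `F i` such that every
`M* ⟶ (F i)*` is an epimorphism. -/
def IsDirectLimitOfDualEpiFP (M : ModuleCat.{u} R ⥤ AddCommGrpCat.{u}) : Prop :=
  ∃ (I : Type u) (_ : Preorder I) (_ : IsDirectedOrder I) (_ : Nonempty I)
    (F : I ⥤ ModuleCat.{u} R ⥤ AddCommGrpCat.{u}) (ι : F ⟶ (Functor.const I).obj M),
    Nonempty (IsColimit (Cocone.mk M ι)) ∧
      ∀ i : I, IsFP (F.obj i) ∧ Mono (ι.app i) ∧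
        Epi (dualMap (ι.app i : F.obj i ⟶ M))

/-- `M` embeds in a product of quasi-coherent functors of finitely presented right modules. -/
def EmbedsInProdFinitelyPresented (M : ModuleCat.{u} R ⥤ AddCommGrpCat.{u}) : Prop :=
  ∃ (J : Type u) (P : J → ModuleCat.{u} Rᵐᵒᵖ)
    (f : M ⟶ ∏ᶜ fun j => (quasiCoherent R).obj (P j)),
    (∀ j, Module.FinitePresentation Rᵐᵒᵖ (P j)) ∧ Mono f

end

end FunctorialModules

/-! Everything rests on a finite description of FP functors. The family of all elements of `F` at
finitely presented modules is one element of `F` at a product; that element comes from a finitely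
presented `A`, so `F` is generated by one `y` in `F A` (`IsFP.exists_generator`). Injectivity on
products shows in the same way that the morphisms killing `y` are those factoring through a single
`g : A ⟶ B` with `B` finitely presented (`IsML.exists_annihilator`). A transpose of a presentation
of `B` encodes this factorization as the vanishing of a tensor, hence an embedding of `F` in some `P
⊗ -` with `P` finitely presented (`IsFP.exists_embedding`).

1 → 2: in an ML functor the subfunctors generated by one element at a finitely presented module are
FP, and they form a direct system with limit `M`. 2 → 3: each `F i` embeds in some `P i ⊗ -`;
surjectivity of the dual maps extends these embeddings to `M`, where they are jointly injective. 3 →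
1: `P ⊗ -` is injective on products, so `M` is ML. On an FP subfunctor `F` finitely many of the
given maps are already jointly injective (`IsFP.exists_finset_jointly_injective`), so some `W : M ⟶
Q ⊗ -`, with `Q` finitely presented, is injective on `F`. Every `F ⟶ N ⊗ -` factors through `W`
restricted to `F` by a map `Q ⟶ N` (`exists_comp_quasiCoherent_map_eq`), hence extends to `M`. -/

namespace FunctorialModules

/-! ### Finite presentations by generators and relations. -/

section FinitePresentation

variable {R : Type u} [Ring R]

/-- A finitely presented module has finitely many generators `a i` and finitely many relations
`ρ j` between them, with the corresponding universal property. -/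
theorem exists_presentation (A : Type u) [AddCommGroup A] [Module R A]
    [Module.FinitePresentation R A] :
    ∃ (n c : ℕ) (a : Fin n → A) (ρ : Fin c → Fin n → R),
      Submodule.span R (Set.range a) = ⊤ ∧ (∀ j, ∑ i, ρ j i • a i = 0) ∧
      ∀ (N : Type u) [AddCommGroup N] [Module R N] (v : Fin n → N),
        (∀ j, ∑ i, ρ j i • v i = 0) → ∃ f : A →ₗ[R] N, ∀ i, f (a i) = v i := by
  obtain ⟨n, K, e, hK⟩ := Module.FinitePresentation.exists_fin R A
  obtain ⟨c, ρ, hρ⟩ := Submodule.fg_iff_exists_fin_generating_family.1 hK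
  have key : ∀ t : Fin n → R, ∑ i, t i • e.symm (K.mkQ (Pi.single i 1)) = e.symm (K.mkQ t) := by
    intro t
    simp_rw [← map_smul, ← map_sum]
    congr 2
    ext i
    simp [Finset.sum_apply, Pi.single_apply]
  refine ⟨n, c, fun i => e.symm (K.mkQ (Pi.single i 1)), ρ, ?_, fun j => ?_, ?_⟩
  · refine eq_top_iff.2 fun x _ => ?_
    obtain ⟨t, ht⟩ := K.mkQ_surjective (e x)
    have : x = ∑ i, t i • e.symm (K.mkQ (Pi.single i 1)) := by
      rw [key, ht, LinearEquiv.symm_apply_apply]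
    rw [this]
    exact Submodule.sum_mem _ fun i _ => Submodule.smul_mem _ _ (Submodule.subset_span ⟨i, rfl⟩)
  · have : K.mkQ (ρ j) = 0 := by
      rw [Submodule.mkQ_apply, Submodule.Quotient.mk_eq_zero, ← hρ]
      exact Submodule.subset_span ⟨j, rfl⟩
    rw [key, this, map_zero]
  · intro N _ _ v hv
    refine ⟨(K.liftQ (Fintype.linearCombination R v) ?_).comp e.toLinearMap, fun i => ?_⟩
    · rw [← hρ, Submodule.span_le]
      rintro _ ⟨j, rfl⟩
      simpa [Fintype.linearCombination_apply] using hv j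
    · simp [Fintype.linearCombination_apply, Pi.single_apply]

end FinitePresentation

/-! ### Direct limits described by elements. -/

section DirectedColimit

variable {I : Type u} [Preorder I]

theorem isColimit_of_elementwise_addCommGrp [IsDirectedOrder I] [Nonempty I]
    (F : I ⥤ AddCommGrpCat.{u}) (c : Cocone F)
    (hsurj : ∀ x : c.pt, ∃ i, ∃ y : F.obj i, c.ι.app i y = x)
    (hinj : ∀ i (y : F.obj i), c.ι.app i y = 0 → ∃ (j : I) (f : i ⟶ j), F.map f y = 0) :
    Nonempty (IsColimit c) := by
  have : ReflectsColimitsOfShape I (forget AddCommGrpCat.{u}) :=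
    reflectsColimitsOfShape_of_reflectsIsomorphisms
  refine ⟨isColimitOfReflects (forget AddCommGrpCat.{u}) ?_⟩
  refine Types.FilteredColimit.isColimitOf' _ _ (fun x => ?_) (fun i x y h => ?_)
  · obtain ⟨i, y, rfl⟩ := hsurj x
    exact ⟨i, y, rfl⟩
  · obtain ⟨j, f, hf⟩ := hinj i (x - y : F.obj i) ((map_sub (c.ι.app i).hom _ _).trans (sub_eq_zero.2 h))
    exact ⟨j, f, sub_eq_zero.1 ((map_sub (F.map f).hom _ _).symm.trans hf)⟩

theorem isColimit_of_elementwise_moduleCat {R : Type u} [Ring R] [IsDirectedOrder I] [Nonempty I]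
    (F : I ⥤ ModuleCat.{u} R) (c : Cocone F)
    (hsurj : ∀ x : c.pt, ∃ i, ∃ y : F.obj i, c.ι.app i y = x)
    (hinj : ∀ i (y : F.obj i), c.ι.app i y = 0 → ∃ (j : I) (f : i ⟶ j), F.map f y = 0) :
    Nonempty (IsColimit c) := by
  refine ⟨isColimitOfReflects (forget (ModuleCat.{u} R)) ?_⟩
  refine Types.FilteredColimit.isColimitOf' _ _ (fun x => ?_) (fun i x y h => ?_)
  · obtain ⟨i, y, rfl⟩ := hsurj x
    exact ⟨i, y, rfl⟩
  · obtain ⟨j, f, hf⟩ := hinj i (x - y : F.obj i) ((map_sub (c.ι.app i).hom _ _).trans (sub_eq_zero.2 h))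
    exact ⟨j, f, sub_eq_zero.1 ((map_sub (F.map f).hom _ _).symm.trans hf)⟩

variable [IsDirectedOrder I] [Nonempty I] {R : Type u} [Ring R]

theorem exists_rep_addCommGrp (F : I ⥤ AddCommGrpCat.{u}) {c : Cocone F} (hc : IsColimit c)
    (x : c.pt) : ∃ i, ∃ y : F.obj i, c.ι.app i y = x :=
  Concrete.isColimit_exists_rep F hc x

theorem exists_map_eq_zero_addCommGrp (F : I ⥤ AddCommGrpCat.{u}) {c : Cocone F}
    (hc : IsColimit c) {i : I} (y : F.obj i) (hy : c.ι.app i y = 0) :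
    ∃ (j : I) (f : i ⟶ j), F.map f y = 0 := by
  obtain ⟨j, f, h⟩ := (hc.eq_iff' y 0).1 (by rw [hy, map_zero])
  exact ⟨j, f, by rw [h, map_zero]⟩

theorem exists_map_eq_zero_moduleCat (F : I ⥤ ModuleCat.{u} R) {c : Cocone F}
    (hc : IsColimit c) {i : I} (y : F.obj i) (hy : c.ι.app i y = 0) :
    ∃ (j : I) (f : i ⟶ j), F.map f y = 0 := by
  obtain ⟨j, f, h⟩ := (hc.eq_iff' y 0).1 (by rw [hy, map_zero])
  exact ⟨j, f, by rw [h, map_zero]⟩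

/-- A morphism from a finitely presented module to a direct limit factors through one of the
terms. -/
theorem exists_factor_of_finitePresentation (F : I ⥤ ModuleCat.{u} R) {c : Cocone F}
    (hc : IsColimit c) (A : ModuleCat.{u} R) [Module.FinitePresentation R A] (h : A ⟶ c.pt) :
    ∃ (i : I) (g : A ⟶ F.obj i), g ≫ c.ι.app i = h := by
  obtain ⟨n, m, a, ρ, ha, hρ, hlift⟩ := exists_presentation (R := R) A
  have hrep : ∀ k : Fin n, ∃ i, ∃ y : F.obj i, c.ι.app i y = h (a k) := fun k =>
    Concrete.isColimit_exists_rep F hc (h (a k))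
  choose i y hy using hrep
  obtain ⟨i₀, hi₀⟩ := Finite.exists_le i
  let z : Fin n → F.obj i₀ := fun k => F.map (homOfLE (hi₀ k)) (y k)
  have hz : ∀ k, c.ι.app i₀ (z k) = h (a k) := fun k => by
    rw [← hy k]
    exact ConcreteCategory.congr_hom (c.w (homOfLE (hi₀ k))) (y k)
  -- The lifted generators satisfy the relations only in the limit; being finitely many, the
  -- relations all hold at a later stage.
  have hrel : ∀ j, ∃ (k : I) (f : i₀ ⟶ k), F.map f (∑ l, ρ j l • z l) = 0 := fun j => by
    refine exists_map_eq_zero_moduleCat F hc _ ?_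
    rw [map_sum]
    simp_rw [map_smul, hz, ← map_smul]
    rw [← map_sum, hρ, map_zero]
  choose k f hf using hrel
  obtain ⟨i₁, hi₁⟩ := Finite.exists_le k
  obtain ⟨i₂, h₀₂, h₁₂⟩ := exists_ge_ge i₀ i₁
  obtain ⟨g, hg⟩ := hlift (F.obj i₂) (fun l => F.map (homOfLE h₀₂) (z l)) (fun j => by
    simp_rw [← map_smul]
    rw [← map_sum]
    have : homOfLE h₀₂ = f j ≫ homOfLE ((hi₁ j).trans h₁₂) := Subsingleton.elim _ _
    rw [this, F.map_comp, ConcreteCategory.comp_apply, hf, map_zero])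
  refine ⟨i₂, ModuleCat.ofHom g, ?_⟩
  ext1
  refine LinearMap.ext_on_range ha fun l => ?_
  change c.ι.app i₂ (g (a l)) = h (a l)
  rw [hg, ← hz l]
  exact ConcreteCategory.congr_hom (c.w (homOfLE h₀₂)) (z l)

end DirectedColimit

/-! ### Every module as a direct limit of finitely presented ones. -/

noncomputable section SystemOfFinitelyPresented

variable {R : Type u} [Ring R] (S : Type u) [AddCommGroup S] [Module R S]

variable (R) in
/-- A finite set of elements of `S` together with a finite set of linear relations between
them. -/
structure FiniteRelations where
  /-- the elements -/
  elts : Finset S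
  /-- the relations -/
  rels : Finset (S →₀ R)
  -- Relations live in `S →₀ R` rather than `elts →₀ R`, so that the order is plain inclusion of
  -- finite sets; this field keeps their support in `elts`.
  supp : ∀ y ∈ rels, y ∈ LinearMap.range (Finsupp.lmapDomain R R (Subtype.val : elts → S))
  rel : ∀ y ∈ rels, Finsupp.linearCombination R (id : S → S) y = 0

namespace FiniteRelations

variable {S}

instance : PartialOrder (FiniteRelations R S) :=
  PartialOrder.lift (fun X => (X.elts, X.rels)) (by
    rintro ⟨⟩ ⟨⟩ h
    simp only [Prod.mk.injEq] at h
    obtain ⟨rfl, rfl⟩ := h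
    rfl)

instance : Nonempty (FiniteRelations R S) := ⟨⟨∅, ∅, by simp, by simp⟩⟩

omit [AddCommGroup S] [Module R S] in
theorem range_lmapDomain_mono {X Y : Finset S} (h : X ⊆ Y) :
    LinearMap.range (Finsupp.lmapDomain R R (Subtype.val : X → S)) ≤
      LinearMap.range (Finsupp.lmapDomain R R (Subtype.val : Y → S)) := by
  rintro _ ⟨t, rfl⟩
  refine ⟨Finsupp.lmapDomain R R (Set.inclusion h) t, ?_⟩
  rw [Finsupp.lmapDomain_apply, Finsupp.lmapDomain_apply, ← Finsupp.mapDomain_comp]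
  rfl

instance : IsDirectedOrder (FiniteRelations R S) where
  directed X Y := by
    classical
    refine ⟨⟨X.elts ∪ Y.elts, X.rels ∪ Y.rels, fun y hy => ?_, fun y hy => ?_⟩,
      ⟨Finset.subset_union_left, Finset.subset_union_left⟩,
      ⟨Finset.subset_union_right, Finset.subset_union_right⟩⟩
    · rcases Finset.mem_union.1 hy with hy | hy
      · exact range_lmapDomain_mono Finset.subset_union_left (X.supp y hy)
      · exact range_lmapDomain_mono Finset.subset_union_right (Y.supp y hy)
    · rcases Finset.mem_union.1 hy with hy | hy
      · exact X.rel y hy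
      · exact Y.rel y hy

/-- The submodule of relations generated by `X.rels`. -/
def relSubmodule (X : FiniteRelations R S) : Submodule R (X.elts →₀ R) :=
  (Submodule.span R (X.rels : Set (S →₀ R))).comap
    (Finsupp.lmapDomain R R (Subtype.val : X.elts → S))

theorem mem_relSubmodule {X : FiniteRelations R S} {t : X.elts →₀ R} :
    t ∈ X.relSubmodule ↔
      Finsupp.mapDomain Subtype.val t ∈ Submodule.span R (X.rels : Set (S →₀ R)) := Iff.rfl

/-- The module with generators `X.elts` and relations `X.rels`. -/
abbrev Mod (X : FiniteRelations R S) : Type u :=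
  (X.elts →₀ R) ⧸ X.relSubmodule

instance (X : FiniteRelations R S) : Module.FinitePresentation R X.Mod := by
  refine Module.finitePresentation_of_surjective X.relSubmodule.mkQ
    (Submodule.mkQ_surjective _) ?_
  rw [Submodule.ker_mkQ]
  refine Submodule.fg_of_fg_map_injective (Finsupp.lmapDomain R R (Subtype.val : X.elts → S))
    (Finsupp.mapDomain_injective Subtype.val_injective) ?_
  rw [relSubmodule, Submodule.map_comap_eq, inf_eq_right.2 (Submodule.span_le.2 X.supp)]
  exact ⟨X.rels, rfl⟩

/-- The transition maps. -/
def trans {X Y : FiniteRelations R S} (h : X ≤ Y) : X.Mod →ₗ[R] Y.Mod :=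
  Submodule.mapQ _ _ (Finsupp.lmapDomain R R (Set.inclusion h.1)) (fun t ht => by
    rw [mem_relSubmodule] at ht
    rw [Submodule.mem_comap, mem_relSubmodule, Finsupp.lmapDomain_apply, ← Finsupp.mapDomain_comp]
    exact Submodule.span_mono (Finset.coe_subset.2 h.2) ht)

@[simp]
theorem trans_mkQ {X Y : FiniteRelations R S} (h : X ≤ Y) (t : X.elts →₀ R) :
    trans h (X.relSubmodule.mkQ t) =
      Y.relSubmodule.mkQ (Finsupp.lmapDomain R R (Set.inclusion h.1) t) := rfl

/-- The evaluation in `S`. -/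
def eval (X : FiniteRelations R S) : X.Mod →ₗ[R] S :=
  Submodule.liftQ _ (Finsupp.linearCombination R (Subtype.val : X.elts → S)) (fun t ht => by
    have : Submodule.span R (X.rels : Set (S →₀ R)) ≤
        LinearMap.ker (Finsupp.linearCombination R (id : S → S)) :=
      Submodule.span_le.2 X.rel
    have h := this (mem_relSubmodule.1 ht)
    rw [LinearMap.mem_ker, Finsupp.linearCombination_mapDomain] at h
    exact h)

@[simp]
theorem eval_mkQ (X : FiniteRelations R S) (t : X.elts →₀ R) :
    X.eval (X.relSubmodule.mkQ t) = Finsupp.linearCombination R (Subtype.val : X.elts → S) t :=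
  rfl

variable (R S) in
/-- The direct system of finitely presented modules over `S`. -/
def system : FiniteRelations R S ⥤ ModuleCat.{u} R where
  obj X := ModuleCat.of R X.Mod
  map f := ModuleCat.ofHom (trans f.le)
  map_id X := by
    ext1
    refine Submodule.linearMap_qext _ (Finsupp.lhom_ext fun a b => ?_)
    simp [trans]
  map_comp f g := by
    ext1
    refine Submodule.linearMap_qext _ (Finsupp.lhom_ext fun a b => ?_)
    simp [trans]

variable (R S) in
/-- The cocone over `system R S` with point `S`. -/
def cocone : Cocone (system R S) where
  pt := ModuleCat.of R S
  ι :=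
    { app X := ModuleCat.ofHom X.eval
      naturality X Y f := by
        ext1
        refine Submodule.linearMap_qext _ (Finsupp.lhom_ext fun a b => ?_)
        change Y.eval (trans f.le (X.relSubmodule.mkQ _)) = X.eval (X.relSubmodule.mkQ _)
        rw [trans_mkQ, eval_mkQ, eval_mkQ]
        simp }

-- Each element of `S` is a generator at some stage, and a combination that evaluates to zero may
-- itself be added to the relations.
variable (R S) in
theorem nonempty_isColimit_cocone : Nonempty (IsColimit (cocone R S)) := by
  classical
  refine isColimit_of_elementwise_moduleCat _ _ (fun x => ?_) (fun X y hy => ?_)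
  · let X : FiniteRelations R S := ⟨{x}, ∅, by simp, by simp⟩
    refine ⟨X, X.relSubmodule.mkQ (Finsupp.single ⟨x, Finset.mem_singleton_self x⟩ 1), ?_⟩
    change X.eval (X.relSubmodule.mkQ _) = _
    rw [eval_mkQ, Finsupp.linearCombination_single]
    exact one_smul R (x : S)
  · obtain ⟨t, rfl⟩ := X.relSubmodule.mkQ_surjective y
    have ht0 : Finsupp.linearCombination R (Subtype.val : X.elts → S) t = 0 := hy
    let Y : FiniteRelations R S := ⟨X.elts, insert (Finsupp.mapDomain Subtype.val t) X.rels,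
      fun y hy => by
        rcases Finset.mem_insert.1 hy with rfl | hy
        · exact ⟨t, rfl⟩
        · exact X.supp y hy,
      fun y hy => by
        rcases Finset.mem_insert.1 hy with rfl | hy
        · rw [Finsupp.linearCombination_mapDomain]
          exact ht0
        · exact X.rel y hy⟩
    have hXY : X ≤ Y := ⟨subset_rfl, Finset.subset_insert _ _⟩
    refine ⟨Y, homOfLE hXY, ?_⟩
    change trans hXY (X.relSubmodule.mkQ t) = 0
    refine (Submodule.Quotient.mk_eq_zero _).2 ?_
    rw [mem_relSubmodule, Finsupp.lmapDomain_apply, ← Finsupp.mapDomain_comp]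
    exact Submodule.subset_span (Finset.mem_insert_self _ _)

end FiniteRelations

end SystemOfFinitelyPresented

/-! ### Reduction of elements and their vanishing to finitely presented modules. -/

section Approximation

variable {R : Type u} [Ring R] {F : ModuleCat.{u} R ⥤ AddCommGrpCat.{u}}

/-- Every element of `F S` comes from a finitely presented module. -/
theorem PreservesDirectLimits.exists_rep (hF : PreservesDirectLimits F) (S : ModuleCat.{u} R)
    (z : F.obj S) : ∃ (B : ModuleCat.{u} R) (k : B ⟶ S) (b : F.obj B),
      Module.FinitePresentation R B ∧ F.map k b = z := by
  have := hF (FiniteRelations R S)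
  obtain ⟨hc⟩ := FiniteRelations.nonempty_isColimit_cocone R S
  obtain ⟨X, b, hb⟩ := exists_rep_addCommGrp _ (isColimitOfPreserves F hc) z
  exact ⟨ModuleCat.of R X.Mod, ModuleCat.ofHom X.eval, b, inferInstance, hb⟩

/-- If `F h` kills an element of `F A`, with `A` finitely presented, then `h` factors through a
morphism of finitely presented modules which already kills it. -/
theorem PreservesDirectLimits.exists_factor (hF : PreservesDirectLimits F)
    {A S : ModuleCat.{u} R} [Module.FinitePresentation R A] (h : A ⟶ S) (y : F.obj A)
    (hy : F.map h y = 0) : ∃ (B : ModuleCat.{u} R) (g : A ⟶ B) (k : B ⟶ S),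
      Module.FinitePresentation R B ∧ g ≫ k = h ∧ F.map g y = 0 := by
  have := hF (FiniteRelations R S)
  obtain ⟨hc⟩ := FiniteRelations.nonempty_isColimit_cocone R S
  obtain ⟨X, g, hg⟩ := exists_factor_of_finitePresentation _ hc A h
  obtain ⟨Y, f, hf⟩ := exists_map_eq_zero_addCommGrp _ (isColimitOfPreserves F hc)
    (i := X) (F.map g y) (by
      have h' : (F.map g ≫ F.map ((FiniteRelations.cocone R S).ι.app X)) y = 0 := by
        rw [← F.map_comp, hg]
        exact hy
      exact h')
  refine ⟨(FiniteRelations.system R S).obj Y, g ≫ (FiniteRelations.system R S).map f,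
    (FiniteRelations.cocone R S).ι.app Y, ?_, ?_, ?_⟩
  · exact inferInstanceAs (Module.FinitePresentation R Y.Mod)
  · exact (Category.assoc _ _ _).trans
      ((congrArg (g ≫ ·) ((FiniteRelations.cocone R S).w f)).trans hg)
  · rw [F.map_comp]
    exact hf

end Approximation


/-! ### Calculus of the balanced tensor product. -/

section BalancedTensor

variable {R : Type u} [Ring R]

/-- The class of `n ⊗ s` in the balanced tensor product. -/
abbrev BalancedTensor.tmul {N S : Type u} [AddCommGroup N] [Module Rᵐᵒᵖ N] [AddCommGroup S]
    [Module R S] (n : N) (s : S) : BalancedTensor R N S :=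
  QuotientAddGroup.mk (n ⊗ₜ[ℤ] s)

namespace BalancedTensor

variable {N S : Type u} [AddCommGroup N] [Module Rᵐᵒᵖ N] [AddCommGroup S] [Module R S]

theorem smul_tmul (n : N) (r : R) (s : S) :
    tmul (R := R) (MulOpposite.op r • n) s = tmul n (r • s) := by
  refine QuotientAddGroup.eq_iff_sub_mem.2 (AddSubgroup.subset_closure ⟨n, r, s, rfl⟩)

/-- `tmul` as a biadditive map. -/
def tmulHom : N →+ S →+ BalancedTensor R N S :=
  AddMonoidHom.mk' (fun n => AddMonoidHom.mk' (fun s => tmul n s) fun s s' => by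
    simp only [tmul, TensorProduct.tmul_add, QuotientAddGroup.mk_add]) fun n n' => by
    ext s
    simp only [tmul, TensorProduct.add_tmul, QuotientAddGroup.mk_add, AddMonoidHom.mk'_apply,
      AddMonoidHom.add_apply]

theorem tmulHom_apply (n : N) (s : S) : tmulHom (R := R) n s = tmul n s := rfl

theorem add_tmul (n n' : N) (s : S) : tmul (R := R) (n + n') s = tmul n s + tmul n' s := by
  simp only [← tmulHom_apply, map_add, AddMonoidHom.add_apply]

theorem tmul_add (n : N) (s s' : S) : tmul (R := R) n (s + s') = tmul n s + tmul n s' := by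
  simp only [← tmulHom_apply, map_add]

theorem zero_tmul (s : S) : tmul (R := R) (0 : N) s = 0 := by
  simp only [← tmulHom_apply, map_zero, AddMonoidHom.zero_apply]

theorem tmul_zero (n : N) : tmul (R := R) n (0 : S) = 0 := by
  simp only [← tmulHom_apply, map_zero]

theorem tmul_sum {ι : Type*} (t : Finset ι) (n : N) (s : ι → S) :
    tmul (R := R) n (∑ i ∈ t, s i) = ∑ i ∈ t, tmul n (s i) := by
  simp only [← tmulHom_apply, map_sum]

theorem sum_tmul {ι : Type*} (t : Finset ι) (n : ι → N) (s : S) :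
    tmul (R := R) (∑ i ∈ t, n i) s = ∑ i ∈ t, tmul (n i) s := by
  simp only [← tmulHom_apply, map_sum, AddMonoidHom.finsetSum_apply]

/-- The additive map induced by a balanced biadditive map. -/
def lift {G : Type*} [AddCommGroup G] (φ : N →+ S →+ G)
    (h : ∀ n (r : R) s, φ (MulOpposite.op r • n) s = φ n (r • s)) : BalancedTensor R N S →+ G :=
  QuotientAddGroup.lift _ (TensorProduct.liftAddHom φ (by intro r n s; simp)) (by
    rw [balancedRel, AddSubgroup.closure_le]
    rintro _ ⟨n, r, s, rfl⟩
    simp [h])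

@[simp]
theorem lift_tmul {G : Type*} [AddCommGroup G] (φ : N →+ S →+ G)
    (h : ∀ n (r : R) s, φ (MulOpposite.op r • n) s = φ n (r • s)) (n : N) (s : S) :
    lift φ h (tmul n s) = φ n s := rfl

theorem exists_sum_tmul {ι : Type*} [Fintype ι] (e : ι → N)
    (he : Submodule.span Rᵐᵒᵖ (Set.range e) = ⊤) (t : BalancedTensor R N S) :
    ∃ x : ι → S, t = ∑ i, tmul (e i) (x i) := by
  obtain ⟨t, rfl⟩ := QuotientAddGroup.mk_surjective t
  induction t using TensorProduct.induction_on with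
  | zero => exact ⟨0, by simp [tmul_zero]⟩
  | tmul m s =>
    have hm : m ∈ Submodule.span Rᵐᵒᵖ (Set.range e) := he ▸ Submodule.mem_top
    obtain ⟨c, rfl⟩ := Submodule.mem_span_range_iff_exists_fun _ |>.1 hm
    refine ⟨fun i => (c i).unop • s, ?_⟩
    change tmul _ _ = _
    rw [sum_tmul]
    refine Finset.sum_congr rfl fun i _ => ?_
    rw [← smul_tmul, MulOpposite.op_unop]
  | add t t' h h' =>
    obtain ⟨x, hx⟩ := h
    obtain ⟨x', hx'⟩ := h'
    refine ⟨x + x', ?_⟩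
    rw [QuotientAddGroup.mk_add, hx, hx', ← Finset.sum_add_distrib]
    exact Finset.sum_congr rfl fun i _ => (tmul_add _ _ _).symm

end BalancedTensor

end BalancedTensor


/-! ### Right exactness of the tensor product, and vanishing of tensors. -/

section RightExactness

theorem exists_addMonoidHom_of_surjective {X Y G : Type*} [AddCommGroup X] [AddCommGroup Y]
    [AddCommGroup G] (π : X →+ Y) (hπ : Function.Surjective π) (g : X →+ G)
    (h : ∀ x, π x = 0 → g x = 0) : ∃ g' : Y →+ G, ∀ x, g' (π x) = g x :=
  ⟨π.liftOfSurjective hπ ⟨g, fun x hx => h x hx⟩,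
    fun x => AddMonoidHom.liftOfRightInverse_comp_apply π _ _ ⟨g, fun x hx => h x hx⟩ x⟩

variable {R : Type u} [Ring R]

namespace BalancedTensor

variable {ι κ : Type} [Fintype ι] [Fintype κ]

/-- The vanishing of a tensor `∑ eᵢ ⊗ xᵢ`, for a right module with generators `eᵢ` and relations
`ρⱼ`. -/
theorem exists_of_sum_mkQ_tmul_eq_zero [DecidableEq ι]
    (ρ : κ → ι → Rᵐᵒᵖ) {S : Type u}
    [AddCommGroup S] [Module R S] (x : ι → S)
    (hx : ∑ i, tmul (R := R)
      ((Submodule.span Rᵐᵒᵖ (Set.range ρ)).mkQ (Pi.single i 1)) (x i) = 0) :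
    ∃ s : κ → S, ∀ i, x i = ∑ j, (ρ j i).unop • s j := by
  let H : (κ → S) →+ (ι → S) := AddMonoidHom.mk' (fun s i => ∑ j, (ρ j i).unop • s j) (by
    intro s s'
    ext i
    simp [Finset.sum_add_distrib])
  let Ψ : (ι → Rᵐᵒᵖ) →+ S →+ (ι → S) ⧸ H.range :=
    AddMonoidHom.mk' (fun t => AddMonoidHom.mk'
      (fun s => QuotientAddGroup.mk' H.range fun i => (t i).unop • s) (by
        intro s s'
        rw [← map_add]
        congr 1
        ext i
        simp)) (by
      intro t t'
      ext s
      change QuotientAddGroup.mk' H.range _ =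
        QuotientAddGroup.mk' H.range _ + QuotientAddGroup.mk' H.range _
      rw [← map_add]
      congr 1
      ext i
      simp [add_smul])
  have hΨ : ∀ t s, Ψ t s = QuotientAddGroup.mk' H.range fun i => (t i).unop • s :=
    fun _ _ => rfl
  let W := Submodule.span Rᵐᵒᵖ (Set.range ρ)
  obtain ⟨Φ, hΦ⟩ := exists_addMonoidHom_of_surjective W.mkQ.toAddMonoidHom W.mkQ_surjective Ψ (by
    intro t ht
    have ht : t ∈ W := (Submodule.Quotient.mk_eq_zero W).1 ht
    obtain ⟨c, rfl⟩ := (Submodule.mem_span_range_iff_exists_fun _).1 ht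
    ext s
    rw [hΨ, AddMonoidHom.zero_apply, QuotientAddGroup.mk'_apply, QuotientAddGroup.eq_zero_iff]
    refine ⟨fun j => (c j).unop • s, ?_⟩
    ext i
    simp [H, Finset.sum_smul, mul_smul])
  have hΦ' : ∀ t s, Φ (W.mkQ t) s = Ψ t s := fun t s => DFunLike.congr_fun (hΦ t) s
  -- `L` maps the tensor product to the cokernel of `H`, sending the given tensor to the class of
  -- `x`; its vanishing puts `x` in the range of `H`.
  let L := lift Φ (by
    intro n r s
    obtain ⟨t, rfl⟩ := W.mkQ_surjective n
    rw [← map_smul, hΦ', hΦ', hΨ, hΨ]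
    congr 1
    ext i
    simp [mul_smul])
  have h0 := congrArg L hx
  rw [map_zero, map_sum] at h0
  have h1 : ∀ i, L (tmul (W.mkQ (Pi.single i 1)) (x i)) =
      QuotientAddGroup.mk' H.range (Pi.single i (x i)) := by
    intro i
    rw [lift_tmul, hΦ', hΨ]
    congr 1
    ext k
    by_cases hk : k = i
    · subst hk; simp
    · simp [hk]
  rw [Finset.sum_congr rfl fun i _ => h1 i, ← map_sum, Finset.univ_sum_single,
    QuotientAddGroup.mk'_apply, QuotientAddGroup.eq_zero_iff] at h0
  obtain ⟨s, hs⟩ := h0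
  exact ⟨s, fun i => (congrFun hs i).symm⟩

/-- The left module with generators `A` and `tⱼ`, and relations `aᵢ = ∑ ρᵢⱼ tⱼ`. -/
abbrev relSubmodule {A : Type u} [AddCommGroup A] [Module R A] (a : ι → A) (ρ : ι → κ → R) :
    Submodule R (A × (κ → R)) :=
  Submodule.span R (Set.range fun i => (a i, -ρ i))

-- By right exactness, tensoring the quotient with `N` gives the cokernel of `N^ι → (N ⊗ A) × N^κ`.
-- If `(t, 0)` dies there, a preimage in `N^ι` is the required `v`.
omit [Fintype κ] in
theorem exists_of_map_relSubmodule_eq_zero {A N : Type u} [AddCommGroup A]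
    [Module R A]
    [AddCommGroup N] [Module Rᵐᵒᵖ N] (a : ι → A) (ρ : ι → κ → R) (t : BalancedTensor R N A)
    (ht : BalancedTensor.map (LinearMap.id : N →ₗ[Rᵐᵒᵖ] N)
      ((relSubmodule a ρ).mkQ ∘ₗ LinearMap.inl R A (κ → R)) t = 0) :
    ∃ v : ι → N, t = ∑ i, tmul (v i) (a i) ∧ ∀ j, ∑ i, MulOpposite.op (ρ i j) • v i = 0 := by
  let H : (ι → N) →+ BalancedTensor R N A × (κ → N) :=
    AddMonoidHom.mk' (fun v => (∑ i, tmul (v i) (a i),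
      fun j => -∑ i, MulOpposite.op (ρ i j) • v i)) (by
    intro v v'
    refine Prod.ext ?_ ?_
    · simp only [Pi.add_apply, add_tmul, Finset.sum_add_distrib, Prod.fst_add]
    · ext j
      simp only [Pi.add_apply, smul_add, Finset.sum_add_distrib, Prod.snd_add]
      abel)
  let q := QuotientAddGroup.mk' H.range
  let Ψ : A × (κ → R) →+ N →+ (BalancedTensor R N A × (κ → N)) ⧸ H.range :=
    AddMonoidHom.mk' (fun z => AddMonoidHom.mk'
      (fun n => q (tmul n z.1, fun j => MulOpposite.op (z.2 j) • n)) (by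
        intro s s'
        rw [← map_add, Prod.mk_add_mk, add_tmul]
        congr 2
        ext i
        simp)) (by
      intro t t'
      ext s
      change q _ = q _ + q _
      rw [← map_add]
      refine congrArg q (Prod.ext (tmul_add _ _ _) ?_)
      ext j
      simp [add_smul])
  have hΨ : ∀ z n, Ψ z n = q (tmul n z.1, fun j => MulOpposite.op (z.2 j) • n) :=
    fun _ _ => rfl
  let W := relSubmodule a ρ
  obtain ⟨Φ, hΦ⟩ := exists_addMonoidHom_of_surjective W.mkQ.toAddMonoidHom W.mkQ_surjective Ψ (by
    intro t ht
    have ht : t ∈ W := (Submodule.Quotient.mk_eq_zero W).1 ht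
    obtain ⟨c, rfl⟩ := (Submodule.mem_span_range_iff_exists_fun _).1 ht
    ext n
    rw [hΨ, AddMonoidHom.zero_apply, QuotientAddGroup.mk'_apply, QuotientAddGroup.eq_zero_iff]
    refine ⟨fun i => MulOpposite.op (c i) • n, ?_⟩
    refine Prod.ext ?_ ?_
    · change ∑ i, tmul _ _ = tmul _ _
      rw [Prod.fst_sum, tmul_sum]
      exact Finset.sum_congr rfl fun i _ => smul_tmul _ _ _
    · ext j
      simp [H, Prod.snd_sum, Finset.sum_smul, mul_smul])
  have hΦ' : ∀ z n, Φ (W.mkQ z) n = Ψ z n := fun z n => DFunLike.congr_fun (hΦ z) n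
  let L : BalancedTensor R N (_ ⧸ W) →+ _ := lift Φ.flip (by
    intro n r s
    obtain ⟨z, rfl⟩ := W.mkQ_surjective s
    rw [← map_smul, AddMonoidHom.flip_apply, AddMonoidHom.flip_apply, hΦ', hΦ', hΨ, hΨ,
      Prod.smul_fst, smul_tmul]
    congr 2
    ext i
    simp [mul_smul])
  have hL : L.comp (BalancedTensor.map (LinearMap.id : N →ₗ[Rᵐᵒᵖ] N)
      (W.mkQ ∘ₗ LinearMap.inl R A (κ → R))) = q.comp (AddMonoidHom.inl _ _) := by
    refine hom_ext fun n s => ?_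
    change Φ (W.mkQ (s, 0)) n = q (tmul n s, 0)
    rw [hΦ', hΨ]
    congr 2
    ext j
    simp
  have h0 : q (t, 0) = 0 := by
    have h1 := DFunLike.congr_fun hL t
    rw [AddMonoidHom.comp_apply, ht, map_zero] at h1
    exact h1.symm
  rw [QuotientAddGroup.mk'_apply, QuotientAddGroup.eq_zero_iff] at h0
  obtain ⟨v, hv⟩ := h0
  refine ⟨v, (congrArg Prod.fst hv).symm, fun j => ?_⟩
  have := congrFun (congrArg Prod.snd hv) j
  exact neg_eq_zero.1 this

end BalancedTensor

end RightExactness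


/-! ### Quasi-coherent functors of finitely presented right modules. -/

section QuasiCoherent

variable {R : Type u} [Ring R]

open BalancedTensor

instance quasiCoherent_obj_additive (N : ModuleCat.{u} Rᵐᵒᵖ) :
    ((quasiCoherent R).obj N).Additive where
  map_add {S S' f g} := by
    ext1
    exact hom_ext fun n s => tmul_add _ _ _

/-- A presentation of a finitely presented right module, with the resulting criterion for the
vanishing of tensors. -/
theorem exists_presentation_tmul (P : Type u) [AddCommGroup P] [Module Rᵐᵒᵖ P]
    [Module.FinitePresentation Rᵐᵒᵖ P] :
    ∃ (n c : ℕ) (e : Fin n → P) (ρ : Fin n → Fin c → R),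
      Submodule.span Rᵐᵒᵖ (Set.range e) = ⊤ ∧
      (∀ j, ∑ i, MulOpposite.op (ρ i j) • e i = 0) ∧
      (∀ (N : Type u) [AddCommGroup N] [Module Rᵐᵒᵖ N] (v : Fin n → N),
        (∀ j, ∑ i, MulOpposite.op (ρ i j) • v i = 0) →
          ∃ f : P →ₗ[Rᵐᵒᵖ] N, ∀ i, f (e i) = v i) ∧
      ∀ (S : Type u) [AddCommGroup S] [Module R S] (x : Fin n → S),
        ∑ i, tmul (R := R) (e i) (x i) = 0 → ∃ s : Fin c → S, ∀ i, x i = ∑ j, ρ i j • s j := by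
  obtain ⟨n, c, e, ρ, he, hρ, hlift⟩ := exists_presentation (R := Rᵐᵒᵖ) P
  refine ⟨n, c, e, fun i j => (ρ j i).unop, he, hρ, hlift, fun S _ _ x hx => ?_⟩
  let W := Submodule.span Rᵐᵒᵖ (Set.range ρ)
  obtain ⟨f, hf⟩ := hlift ((Fin n → Rᵐᵒᵖ) ⧸ W) (fun i => W.mkQ (Pi.single i 1)) (fun j => by
    simp_rw [← map_smul]
    rw [← map_sum]
    refine (Submodule.Quotient.mk_eq_zero _).2 (Submodule.subset_span ⟨j, ?_⟩)
    ext i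
    simp [Finset.sum_apply, Pi.single_apply])
  refine exists_of_sum_mkQ_tmul_eq_zero ρ x ?_
  have := congrArg (BalancedTensor.map f (LinearMap.id : S →ₗ[R] S)) hx
  rw [map_zero, map_sum] at this
  rw [← this]
  refine Finset.sum_congr rfl fun i _ => ?_
  rw [map_mk, hf]
  rfl

/-- `P ⊗ ∏ Sᵢ → ∏ P ⊗ Sᵢ` is injective for a finitely presented right module `P`. -/
theorem injective_toProd_quasiCoherent (P : ModuleCat.{u} Rᵐᵒᵖ)
    [Module.FinitePresentation Rᵐᵒᵖ P] {I : Type u} (S : I → ModuleCat.{u} R)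
    (t : ((quasiCoherent R).obj P).obj (ModuleCat.of R (∀ i, S i)))
    (ht : ∀ i, toProd ((quasiCoherent R).obj P) S t i = 0) : t = 0 := by
  obtain ⟨n, c, e, ρ, he, hρ, -, hvan⟩ := exists_presentation_tmul (R := R) P
  obtain ⟨x, hx⟩ := exists_sum_tmul (R := R) (S := ∀ i, S i) e he t
  have hs : ∀ i, ∃ s : Fin c → S i, ∀ k, x k i = ∑ j, ρ k j • s j := fun i => by
    refine hvan (S i) (fun k => x k i) ?_
    have h := ht i
    rw [hx] at h
    refine Eq.trans ?_ h
    exact (map_sum (BalancedTensor.map (LinearMap.id : P →ₗ[Rᵐᵒᵖ] P)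
      (LinearMap.proj i : (∀ i, S i) →ₗ[R] S i)) (fun k => tmul (e k) (x k)) Finset.univ).symm
  -- The number `c` of relations does not depend on `i`, so the witnesses assemble into `c` elements
  -- of the product.
  choose s hs using hs
  have hx' : ∀ k, x k = ∑ j, ρ k j • fun i => s i j := fun k => by
    ext i
    rw [hs, Finset.sum_apply]
    rfl
  refine hx.trans ?_
  simp_rw [hx', tmul_sum, ← smul_tmul]
  rw [Finset.sum_comm]
  simp_rw [← sum_tmul, hρ, zero_tmul]
  exact Finset.sum_const_zero

/-- If `F` is generated by one element, then every `F ⟶ N ⊗ -` extends along every monomorphism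
`F ⟶ P ⊗ -` with `P` finitely presented. -/
theorem exists_comp_quasiCoherent_map_eq {F : ModuleCat.{u} R ⥤ AddCommGrpCat.{u}}
    {P N : ModuleCat.{u} Rᵐᵒᵖ} [Module.FinitePresentation Rᵐᵒᵖ P] (w : F ⟶ (quasiCoherent R).obj P)
    (hw : ∀ S (z : F.obj S), w.app S z = 0 → z = 0) (v : F ⟶ (quasiCoherent R).obj N)
    {A : ModuleCat.{u} R} (y : F.obj A) (hy : ∀ S (z : F.obj S), ∃ h : A ⟶ S, F.map h y = z) :
    ∃ f : P ⟶ N, w ≫ (quasiCoherent R).map f = v := by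
  obtain ⟨n, c, e, ρ, he, hρ, hlift, -⟩ := exists_presentation_tmul (R := R) P
  obtain ⟨a, ha⟩ := exists_sum_tmul (R := R) (S := A) e he (w.app A y)
  -- This quotient of `A × R^c` is the universal way to write `aᵢ = ∑ ρᵢⱼ tⱼ`. The relations of `P`
  -- then make `∑ eᵢ ⊗ aᵢ`, the image of `w y`, vanish, so `h` kills `y` and therefore `v y`.
  let W := BalancedTensor.relSubmodule a ρ
  let h₀ : A →ₗ[R] (A × (Fin c → R)) ⧸ W := W.mkQ ∘ₗ LinearMap.inl R A (Fin c → R)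
  let h : A ⟶ ModuleCat.of R ((A × (Fin c → R)) ⧸ W) := ModuleCat.ofHom h₀
  have hza : ∀ i, h₀ (a i) = ∑ j, ρ i j • W.mkQ (0, Pi.single j 1) := fun i => by
    simp_rw [← map_smul]
    rw [← map_sum]
    refine (Submodule.Quotient.eq W).2 (Submodule.subset_span ⟨i, ?_⟩)
    refine Prod.ext ?_ ?_
    · simp [Prod.fst_sum]
    · ext j
      simp [Prod.snd_sum, Finset.sum_apply, Pi.single_apply]
  have hwy : w.app _ (F.map h y) = 0 := by
    rw [NatTrans.naturality_apply, ha]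
    refine (map_sum (BalancedTensor.map (LinearMap.id : P →ₗ[Rᵐᵒᵖ] P) h₀) _ _).trans ?_
    simp_rw [map_mk, hza, LinearMap.id_apply]
    change ∑ i, tmul (e i) (∑ j, ρ i j • W.mkQ (0, Pi.single j 1)) = 0
    simp_rw [tmul_sum, ← smul_tmul]
    rw [Finset.sum_comm]
    simp_rw [← sum_tmul, hρ, zero_tmul]
    exact Finset.sum_const_zero
  have hvy : BalancedTensor.map (LinearMap.id : N →ₗ[Rᵐᵒᵖ] N) h₀ (v.app A y) = 0 := by
    have := NatTrans.naturality_apply v h y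
    rw [hw _ _ hwy, map_zero] at this
    exact this.symm
  -- The `bᵢ` satisfy the relations of `P`, so `eᵢ ↦ bᵢ` defines `f : P → N`, and `f` sends `w y` to
  -- `v y`.
  obtain ⟨b, hb, hbρ⟩ := exists_of_map_relSubmodule_eq_zero a ρ _ hvy
  obtain ⟨f, hf⟩ := hlift N b hbρ
  refine ⟨ModuleCat.ofHom f, ?_⟩
  have hfy : ((quasiCoherent R).map (ModuleCat.ofHom f)).app A (w.app A y) = v.app A y := by
    rw [ha, hb]
    refine (map_sum (BalancedTensor.map f (LinearMap.id : A →ₗ[R] A)) _ _).trans ?_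
    simp_rw [map_mk, hf]
    rfl
  ext S z
  obtain ⟨k, rfl⟩ := hy S z
  rw [NatTrans.comp_app, ConcreteCategory.comp_apply, NatTrans.naturality_apply,
    NatTrans.naturality_apply, NatTrans.naturality_apply, hfy]

end QuasiCoherent


/-! ### One generator, one annihilating morphism, and the embedding of FP functors. -/

section Generators

variable {R : Type u} [Ring R]

variable (R) in
/-- Indices for a set of representatives of the finitely presented modules. -/
abbrev PresentationIndex : Type u := Σ n : ℕ, Finset (Fin n → R)

/-- The finitely presented module with a given index. -/
abbrev PresentationIndex.mod (X : PresentationIndex R) : ModuleCat.{u} R :=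
  ModuleCat.of R ((Fin X.1 → R) ⧸ Submodule.span R (X.2 : Set (Fin X.1 → R)))

instance (X : PresentationIndex R) : Module.FinitePresentation R X.mod :=
  Module.finitePresentation_of_surjective (Submodule.mkQ _) (Submodule.mkQ_surjective _) (by
    rw [Submodule.ker_mkQ]
    exact ⟨X.2, rfl⟩)

theorem exists_iso_mod (B : ModuleCat.{u} R) [Module.FinitePresentation R B] :
    ∃ X : PresentationIndex R, Nonempty (B ≅ X.mod) := by
  obtain ⟨n, K, e, s, rfl⟩ := Module.FinitePresentation.exists_fin R B
  exact ⟨⟨n, s⟩, ⟨e.toModuleIso⟩⟩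

variable {F : ModuleCat.{u} R ⥤ AddCommGrpCat.{u}}

theorem IsFP.isML (hF : IsFP F) : IsML F :=
  ⟨hF.additive, hF.preservesDirectLimits, fun S => (hF.bijective_toProd S).injective⟩

theorem functor_map_comp_apply {S T U : ModuleCat.{u} R} (f : S ⟶ T) (g : T ⟶ U) (x : F.obj S) :
    F.map (f ≫ g) x = F.map g (F.map f x) := by
  rw [F.map_comp, ConcreteCategory.comp_apply]

theorem toProd_map {I : Type u} (S : I → ModuleCat.{u} R) {A : ModuleCat.{u} R}
    (h : ∀ i, A ⟶ S i) (y : F.obj A) (i : I) :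
    toProd F S (F.map (ModuleCat.ofHom (LinearMap.pi fun i => (h i).hom)) y) i =
      F.map (h i) y :=
  (functor_map_comp_apply (F := F) _ _ y).symm

/-- An FP functor is generated by one element of its value at a finitely presented module. -/
theorem IsFP.exists_generator (hF : IsFP F) :
    ∃ (A : ModuleCat.{u} R) (y : F.obj A), Module.FinitePresentation R A ∧
      ∀ S (z : F.obj S), ∃ h : A ⟶ S, F.map h y = z := by
  -- One factor for each element at each representative: the element `Y` below has every such
  -- element as a coordinate.
  let T : (Σ X : PresentationIndex R, F.obj X.mod) → ModuleCat.{u} R := fun t => t.1.mod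
  obtain ⟨Y, hY⟩ := (hF.bijective_toProd T).surjective (fun t => t.2)
  obtain ⟨A, k, y, hA, rfl⟩ := hF.preservesDirectLimits.exists_rep _ Y
  refine ⟨A, y, hA, fun S z => ?_⟩
  obtain ⟨B, k', b, hB, rfl⟩ := hF.preservesDirectLimits.exists_rep S z
  obtain ⟨X, ⟨e⟩⟩ := exists_iso_mod B
  let t : Σ X : PresentationIndex R, F.obj X.mod := ⟨X, F.map e.hom b⟩
  let p : ModuleCat.of R (∀ t, T t) ⟶ X.mod :=
    ModuleCat.ofHom (LinearMap.proj t : (∀ t, T t) →ₗ[R] T t)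
  have hp : F.map p (F.map k y) = F.map e.hom b := congrFun hY t
  refine ⟨k ≫ p ≫ e.inv ≫ k', ?_⟩
  rw [functor_map_comp_apply, functor_map_comp_apply, functor_map_comp_apply, hp, ← functor_map_comp_apply (F := F) e.hom,
    e.hom_inv_id, F.map_id]
  rfl

/-- The morphisms from a finitely presented module which kill a given element of an ML functor
are the multiples of a single morphism to a finitely presented module. -/
theorem IsML.exists_annihilator (hF : IsML F) (A : ModuleCat.{u} R)
    [Module.FinitePresentation R A] (y : F.obj A) :
    ∃ (B : ModuleCat.{u} R) (g : A ⟶ B), Module.FinitePresentation R B ∧ F.map g y = 0 ∧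
      ∀ S (h : A ⟶ S), F.map h y = 0 → ∃ k : B ⟶ S, g ≫ k = h := by
  -- All morphisms from `A` to representatives that kill `y` are combined into one `H`, which kills
  -- `y` by injectivity on products; `B` then replaces the large product.
  let T : (Σ X : PresentationIndex R, {h : A ⟶ X.mod // F.map h y = 0}) → ModuleCat.{u} R :=
    fun t => t.1.mod
  let H : A ⟶ ModuleCat.of R (∀ t, T t) :=
    ModuleCat.ofHom (LinearMap.pi fun t => t.2.1.hom)
  have hH : F.map H y = 0 := by
    refine hF.injective_toProd T (funext fun t => ?_)
    refine (toProd_map T (fun t => t.2.1) y t).trans (t.2.2.trans ?_)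
    exact (map_zero (F.map _).hom).symm
  obtain ⟨B, g, k, hB, hgk, hg⟩ := hF.preservesDirectLimits.exists_factor H y hH
  refine ⟨B, g, hB, hg, fun S h hh => ?_⟩
  obtain ⟨B', g', k', hB', rfl, hg'⟩ := hF.preservesDirectLimits.exists_factor h y hh
  obtain ⟨X, ⟨e⟩⟩ := exists_iso_mod B'
  let t : Σ X : PresentationIndex R, {h : A ⟶ X.mod // F.map h y = 0} :=
    ⟨X, g' ≫ e.hom, by rw [functor_map_comp_apply, hg', map_zero]⟩
  let p : ModuleCat.of R (∀ t, T t) ⟶ X.mod :=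
    ModuleCat.ofHom (LinearMap.proj t : (∀ t, T t) →ₗ[R] T t)
  have hp : H ≫ p = g' ≫ e.hom := rfl
  refine ⟨k ≫ p ≫ e.inv ≫ k', ?_⟩
  rw [reassoc_of% hgk, reassoc_of% hp, e.hom_inv_id_assoc]

/-- A morphism of functors from a functor generated by one element `y` may be prescribed on
`y`. -/
theorem exists_hom_of_generator [F.Additive] {G : ModuleCat.{u} R ⥤ AddCommGrpCat.{u}}
    [G.Additive] {A : ModuleCat.{u} R} {y : F.obj A}
    (hy : ∀ S (z : F.obj S), ∃ h : A ⟶ S, F.map h y = z) (t : G.obj A)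
    (ht : ∀ S (h : A ⟶ S), F.map h y = 0 → G.map h t = 0) :
    ∃ w : F ⟶ G, ∀ S (h : A ⟶ S), w.app S (F.map h y) = G.map h t := by
  choose r hr using hy
  -- Additivity reduces independence of the chosen `r` to the morphism `h - h'`, which kills `y`.
  have hwd : ∀ S (h h' : A ⟶ S), F.map h y = F.map h' y → G.map h t = G.map h' t := by
    intro S h h' hh
    have := ht S (h - h') (by
      rw [F.map_sub]
      exact sub_eq_zero.2 hh)
    rw [G.map_sub] at this
    exact sub_eq_zero.1 this
  refine ⟨{
    app S := AddCommGrpCat.ofHom (AddMonoidHom.mk' (fun z => G.map (r S z) t) fun z z' => ?_)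
    naturality S S' f := ?_ }, fun S h => hwd _ _ _ (hr _ _)⟩
  · have : (G.map (r S z) t + G.map (r S z') t : G.obj S) = G.map (r S z + r S z') t := by
      rw [G.map_add]
      rfl
    rw [this]
    refine hwd _ _ _ ?_
    rw [hr, F.map_add]
    change _ = F.map _ y + F.map _ y
    rw [hr, hr]
  · ext z
    change G.map (r S' (F.map f z)) t = G.map f (G.map (r S z) t)
    rw [← functor_map_comp_apply]
    refine hwd _ _ _ ?_
    rw [hr, functor_map_comp_apply, hr]

open BalancedTensor

/-- Given finitely many elements `bᵢ` of a finitely presented left module `B`, there are elements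
`pᵢ` of a finitely presented right module such that `∑ pᵢ ⊗ xᵢ = 0` if and only if `bᵢ ↦ xᵢ`
extends to a homomorphism on `B`. -/
theorem exists_sum_tmul_eq_zero_iff (B : Type u) [AddCommGroup B] [Module R B]
    [Module.FinitePresentation R B] {n : ℕ} (b : Fin n → B) :
    ∃ (P : ModuleCat.{u} Rᵐᵒᵖ) (p : Fin n → P), Module.FinitePresentation Rᵐᵒᵖ P ∧
      ∀ (S : Type u) [AddCommGroup S] [Module R S] (x : Fin n → S),
        ∑ i, tmul (R := R) (p i) (x i) = 0 ↔ ∃ k : B →ₗ[R] S, ∀ i, k (b i) = x i := by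
  obtain ⟨m, c, β, z, hβ, hz, hlift⟩ := exists_presentation (R := R) B
  have hb : ∀ i, ∃ q : Fin m → R, ∑ j, q j • β j = b i := fun i =>
    (Submodule.mem_span_range_iff_exists_fun _).1 (hβ ▸ Submodule.mem_top)
  choose q hq using hb
  -- Transposed presentation: each generator `βⱼ` of `B` gives a relation on `P`, whose generators
  -- stand for the `bᵢ` and the relations of `B`. With zero paired to the latter, a tensor vanishes
  -- exactly when some `βⱼ ↦ sⱼ` respects the relations of `B` and sends `bᵢ` to `xᵢ`.
  let ρ : Fin m → Fin n ⊕ Fin c → Rᵐᵒᵖ := fun j =>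
    Sum.elim (fun i => MulOpposite.op (q i j)) (fun l => MulOpposite.op (z l j))
  let W := Submodule.span Rᵐᵒᵖ (Set.range ρ)
  let e : Fin n ⊕ Fin c → ((Fin n ⊕ Fin c → Rᵐᵒᵖ) ⧸ W) := fun i => W.mkQ (Pi.single i 1)
  have hrel : ∀ j, ∑ i, ρ j i • e i = 0 := fun j => by
    simp_rw [e, ← map_smul]
    rw [← map_sum]
    refine (Submodule.Quotient.mk_eq_zero _).2 (Submodule.subset_span ⟨j, ?_⟩)
    ext i
    simp [Finset.sum_apply, Pi.single_apply]
  refine ⟨ModuleCat.of Rᵐᵒᵖ ((Fin n ⊕ Fin c → Rᵐᵒᵖ) ⧸ W), fun i => e (Sum.inl i), ?_,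
    fun S _ _ x => ⟨fun hx => ?_, ?_⟩⟩
  · refine Module.finitePresentation_of_surjective W.mkQ W.mkQ_surjective ?_
    rw [Submodule.ker_mkQ]
    exact Submodule.fg_span (Set.finite_range ρ)
  · obtain ⟨s, hs⟩ := exists_of_sum_mkQ_tmul_eq_zero ρ (Sum.elim x 0 : Fin n ⊕ Fin c → S) (by
      rw [Fintype.sum_sum_type]
      simp only [Sum.elim_inl, Sum.elim_inr, Pi.zero_apply, tmul_zero, Finset.sum_const_zero,
        add_zero]
      exact hx)
    obtain ⟨k, hk⟩ := hlift S s (fun l => (hs (Sum.inr l)).symm)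
    refine ⟨k, fun i => ?_⟩
    rw [← hq, map_sum]
    simp_rw [map_smul, hk]
    exact (hs (Sum.inl i)).symm
  · rintro ⟨k, hk⟩
    have h1 : ∀ i, tmul (R := R) (e i) ((Sum.elim x 0 : Fin n ⊕ Fin c → S) i) =
        ∑ j, tmul (ρ j i • e i) (k (β j)) := by
      rintro (i | l)
      · simp only [Sum.elim_inl]
        rw [← hk, ← hq, map_sum, tmul_sum]
        simp_rw [map_smul, ← smul_tmul]
        rfl
      · have : ∑ j, z l j • k (β j) = 0 := by
          simp_rw [← map_smul]
          rw [← map_sum, hz, map_zero]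
        simp only [Sum.elim_inr, Pi.zero_apply]
        rw [← this, tmul_sum]
        simp_rw [← smul_tmul]
        rfl
    have h2 := Finset.sum_congr (s₁ := Finset.univ) rfl fun i _ => h1 i
    rw [Finset.sum_comm] at h2
    simp_rw [← sum_tmul, hrel, zero_tmul] at h2
    rw [Fintype.sum_sum_type] at h2
    simpa only [Sum.elim_inl, Sum.elim_inr, Pi.zero_apply, tmul_zero, Finset.sum_const_zero,
      add_zero] using h2

/-- An FP functor embeds in the quasi-coherent functor of a finitely presented right module. -/
theorem IsFP.exists_embedding (hF : IsFP F) :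
    ∃ (P : ModuleCat.{u} Rᵐᵒᵖ) (w : F ⟶ (quasiCoherent R).obj P),
      Module.FinitePresentation Rᵐᵒᵖ P ∧ ∀ S (z : F.obj S), w.app S z = 0 → z = 0 := by
  have := hF.additive
  obtain ⟨A, y, hA, hy⟩ := hF.exists_generator
  obtain ⟨B, g, hB, hg, hann⟩ := hF.isML.exists_annihilator A y
  obtain ⟨n, -, a, -, ha, -⟩ := exists_presentation (R := R) A
  -- A morphism `h` kills `y` iff it factors through `g`, iff `∑ pᵢ ⊗ h aᵢ = 0`. So `y ↦ ∑ pᵢ ⊗ aᵢ`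
  -- is both well defined and injective.
  obtain ⟨P, p, hP, hp⟩ := exists_sum_tmul_eq_zero_iff (R := R) B (fun i => g (a i))
  have hmap : ∀ S (h : A ⟶ S), ((quasiCoherent R).obj P).map h
      (∑ i, tmul (R := R) (p i) (a i) : BalancedTensor R P A) =
        ∑ i, tmul (R := R) (p i) (h (a i)) := fun S h =>
    map_sum (BalancedTensor.map (LinearMap.id : P →ₗ[Rᵐᵒᵖ] P) h.hom)
      (fun i => tmul (p i) (a i)) Finset.univ
  obtain ⟨w, hw⟩ := exists_hom_of_generator (G := (quasiCoherent R).obj P) hy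
    (∑ i, tmul (R := R) (p i) (a i) : BalancedTensor R P A) (fun S h hh => by
      obtain ⟨k, rfl⟩ := hann S h hh
      exact (hmap S _).trans ((hp S _).2 ⟨k.hom, fun i => rfl⟩))
  refine ⟨P, w, hP, fun S z hz => ?_⟩
  obtain ⟨h, rfl⟩ := hy S z
  rw [hw] at hz
  obtain ⟨k, hk⟩ := (hp S _).1 ((hmap S h).symm.trans hz)
  have : h = g ≫ ModuleCat.ofHom k := by
    ext1
    exact LinearMap.ext_on_range ha fun i => (hk i).symm
  rw [this, functor_map_comp_apply, hg, map_zero]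

end Generators


/-! ### Compactness: finite jointly injective subfamilies. -/

section Compactness

variable {R : Type u} [Ring R] {F : ModuleCat.{u} R ⥤ AddCommGrpCat.{u}}

theorem toProd_app {G : ModuleCat.{u} R ⥤ AddCommGrpCat.{u}} (w : F ⟶ G) {I : Type u}
    (S : I → ModuleCat.{u} R) (x : F.obj (ModuleCat.of R (∀ i, S i))) (i : I) :
    toProd G S (w.app _ x) i = w.app _ (toProd F S x i) :=
  (NatTrans.naturality_apply w _ x).symm

/-- A jointly injective family of morphisms from an FP functor to functors `Z j` for which
`Z j (∏ Sᵢ) → ∏ Z j (Sᵢ)` is injective has a finite jointly injective subfamily. -/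
theorem IsFP.exists_finset_jointly_injective (hF : IsFP F) {J : Type u}
    {Z : J → ModuleCat.{u} R ⥤ AddCommGrpCat.{u}}
    (hZ : ∀ j {I : Type u} (S : I → ModuleCat.{u} R)
      (t : (Z j).obj (ModuleCat.of R (∀ i, S i))), (∀ i, toProd (Z j) S t i = 0) → t = 0)
    (w : ∀ j, F ⟶ Z j) (hw : ∀ S (z : F.obj S), (∀ j, (w j).app S z = 0) → z = 0) :
    ∃ E : Finset J, ∀ S (z : F.obj S), (∀ j ∈ E, (w j).app S z = 0) → z = 0 := by
  classical
  by_contra! hcon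
  choose S z hz hz0 using hcon
  -- `D E` is the product of the counterexample modules `S E'` over `E' ⊇ E`, with transition maps
  -- forgetting coordinates; `y E` below has coordinates `z E'`.
  let D : Finset J ⥤ ModuleCat.{u} R :=
    { obj E := ModuleCat.of R (∀ E' : {E' : Finset J // E ≤ E'}, S E'.1)
      map {E₁ E₂} f := ModuleCat.ofHom (LinearMap.pi fun E' =>
        (LinearMap.proj (⟨E'.1, f.le.trans E'.2⟩ : {E' : Finset J // E₁ ≤ E'}) :
          (∀ E' : {E' : Finset J // E₁ ≤ E'}, S E'.1) →ₗ[R] S E'.1))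
      map_id _ := rfl
      map_comp _ _ := rfl }
  have hex : ∀ E, ∃ y : F.obj (D.obj E),
      toProd F (fun E' : {E' : Finset J // E ≤ E'} => S E'.1) y =
        fun E' : {E' : Finset J // E ≤ E'} => z E'.1 :=
    fun E => (hF.bijective_toProd fun E' : {E' : Finset J // E ≤ E'} => S E'.1).surjective _
  choose y hy using hex
  have hmap : ∀ {E₁ E₂} (f : E₁ ⟶ E₂), F.map (D.map f) (y E₁) = y E₂ := fun {E₁ E₂} f => by
    refine (hF.bijective_toProd (fun E' : {E' : Finset J // E₂ ≤ E'} => S E'.1)).injective ?_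
    rw [hy]
    ext E'
    refine (functor_map_comp_apply (F := F) _ _ _).symm.trans ?_
    exact congrFun (hy E₁) ⟨E'.1, f.le.trans E'.2⟩
  have := hF.preservesDirectLimits (Finset J)
  have hc := isColimitOfPreserves F (colimit.isColimit D)
  have hY : ∀ E, F.map (colimit.ι D ∅) (y ∅) = F.map (colimit.ι D E) (y E) := fun E => by
    rw [← colimit.w D (homOfLE (Finset.empty_subset E)), functor_map_comp_apply, hmap]
  -- All `y E` have the same image in the limit, and `w j` kills `y {j}` coordinatewise. Once this
  -- image is zero, some `y E` is zero, against its coordinate `z E ≠ 0`.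
  have hY0 : F.map (colimit.ι D ∅) (y ∅) = 0 := by
    refine hw _ _ fun j => ?_
    rw [hY {j}, NatTrans.naturality_apply]
    have : (w j).app _ (y {j}) = 0 := by
      refine hZ j (fun E' : {E' : Finset J // {j} ≤ E'} => S E'.1) _ fun E' => ?_
      rw [toProd_app, hy]
      exact hz _ _ (Finset.singleton_subset_iff.1 E'.2)
    rw [this, map_zero]
  obtain ⟨E, f, hf⟩ := exists_map_eq_zero_addCommGrp _ hc (i := (∅ : Finset J)) (y ∅) hY0
  have hyE : y E = 0 := (hmap f).symm.trans hf
  refine hz0 E ?_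
  have h1 := congrFun (hy E) ⟨E, le_rfl⟩
  rw [hyE] at h1
  exact h1.symm.trans (map_zero (F.map _).hom)

end Compactness

/-! ### Subfunctors generated by one element, and their direct system. -/

noncomputable section CyclicSubfunctor

variable {R : Type u} [Ring R] (M : ModuleCat.{u} R ⥤ AddCommGrpCat.{u}) [M.Additive]

/-- The values on `S` of the subfunctor of `M` generated by `x`. -/
def cyclicAddSubgroup {A : ModuleCat.{u} R} (x : M.obj A) (S : ModuleCat.{u} R) :
    AddSubgroup (M.obj S) :=
  AddMonoidHom.range (AddMonoidHom.mk' (fun h : A ⟶ S => M.map h x) fun h h' => by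
    rw [M.map_add]
    rfl)

variable {M} in
theorem mem_cyclicAddSubgroup {A : ModuleCat.{u} R} {x : M.obj A} {S : ModuleCat.{u} R}
    {z : M.obj S} : z ∈ cyclicAddSubgroup M x S ↔ ∃ h : A ⟶ S, M.map h x = z := Iff.rfl

/-- The subfunctor of `M` generated by `x`. -/
def cyclicSubfunctor {A : ModuleCat.{u} R} (x : M.obj A) :
    ModuleCat.{u} R ⥤ AddCommGrpCat.{u} where
  obj S := AddCommGrpCat.of (cyclicAddSubgroup M x S)
  map {S S'} f := AddCommGrpCat.ofHom
    (((M.map f).hom.comp (cyclicAddSubgroup M x S).subtype).codRestrict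
      (cyclicAddSubgroup M x S') (by
        rintro ⟨_, h, rfl⟩
        exact ⟨h ≫ f, functor_map_comp_apply _ _ _⟩))
  map_id S := by
    ext1
    exact AddMonoidHom.ext fun z =>
      Subtype.ext (ConcreteCategory.congr_hom (M.map_id S) z.1)
  map_comp f g := by
    ext1
    exact AddMonoidHom.ext fun z =>
      Subtype.ext (ConcreteCategory.congr_hom (M.map_comp f g) z.1)

/-- The inclusion of the subfunctor of `M` generated by `x`. -/
def cyclicSubfunctorι {A : ModuleCat.{u} R} (x : M.obj A) : cyclicSubfunctor M x ⟶ M where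
  app S := AddCommGrpCat.ofHom (cyclicAddSubgroup M x S).subtype

variable {M}

theorem cyclicSubfunctorι_injective {A : ModuleCat.{u} R} (x : M.obj A) (S : ModuleCat.{u} R) :
    Function.Injective ((cyclicSubfunctorι M x).app S) := Subtype.val_injective

instance {A : ModuleCat.{u} R} (x : M.obj A) : Mono (cyclicSubfunctorι M x) :=
  have (S : ModuleCat.{u} R) : Mono ((cyclicSubfunctorι M x).app S) :=
    (AddCommGrpCat.mono_iff_injective _).2 (cyclicSubfunctorι_injective x S)
  NatTrans.mono_of_mono_app _

/-- The subfunctor of an ML functor generated by an element of its value at a finitely presented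
module is FP. -/
theorem IsML.isFP_cyclicSubfunctor (hM : IsML M) {A : ModuleCat.{u} R}
    [Module.FinitePresentation R A] (x : M.obj A) : IsFP (cyclicSubfunctor M x) where
  additive :=
    { map_add {S S' f g} := by
        ext z
        refine Subtype.ext ?_
        change M.map (f + g) z.1 = M.map f z.1 + M.map g z.1
        rw [M.map_add]
        rfl }
  preservesDirectLimits I _ _ _ := ⟨fun {K} => ⟨fun {c} hc => by
    have := hM.preservesDirectLimits I
    have hMc := isColimitOfPreserves M hc
    refine isColimit_of_elementwise_addCommGrp _ _ ?_ ?_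
    · rintro ⟨_, h, rfl⟩
      obtain ⟨i, g, rfl⟩ := exists_factor_of_finitePresentation K hc A h
      exact ⟨i, ⟨M.map g x, g, rfl⟩, Subtype.ext (functor_map_comp_apply _ _ _).symm⟩
    · intro i y hy
      obtain ⟨j, f, hf⟩ := exists_map_eq_zero_addCommGrp _ hMc (i := i) y.1
        (congrArg Subtype.val hy)
      exact ⟨j, f, Subtype.ext hf⟩⟩⟩
  bijective_toProd {I} S := by
    refine ⟨fun z z' h => ?_, fun z => ?_⟩
    · refine Subtype.ext (hM.injective_toProd S (funext fun i => ?_))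
      exact congrArg Subtype.val (congrFun h i)
    -- Injectivity comes from `M`, but surjectivity needs a single generator: the morphisms reaching
    -- the coordinates combine into one morphism to the product.
    · choose h hh using fun i => mem_cyclicAddSubgroup.1 (z i).2
      refine ⟨⟨_, ModuleCat.ofHom (LinearMap.pi fun i => (h i).hom), rfl⟩, ?_⟩
      ext i
      exact Subtype.ext ((toProd_map S h x i).trans (hh i))

variable (M) in
/-- The elements of the values of `M` at finitely presented modules. -/
def ElementIndex : Type u := Σ X : PresentationIndex R, M.obj X.mod

/-- A morphism carrying the generator of `t` to that of `s` puts the subfunctor of `s` inside that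
of `t`. Only its existence is recorded, so the system is indexed by a preorder. -/
instance : Preorder (ElementIndex M) where
  le s t := ∃ g : t.1.mod ⟶ s.1.mod, M.map g t.2 = s.2
  le_refl s := ⟨𝟙 _, by rw [M.map_id]; rfl⟩
  le_trans s t r := by
    rintro ⟨g, hg⟩ ⟨g', hg'⟩
    exact ⟨g' ≫ g, by rw [functor_map_comp_apply, hg', hg]⟩

omit [M.Additive] in
theorem ElementIndex.exists_ge (B : ModuleCat.{u} R) [Module.FinitePresentation R B]
    (b : M.obj B) : ∃ (t : ElementIndex M) (g : t.1.mod ⟶ B), M.map g t.2 = b := by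
  obtain ⟨X, ⟨e⟩⟩ := exists_iso_mod B
  refine ⟨⟨X, M.map e.hom b⟩, e.inv, ?_⟩
  rw [← functor_map_comp_apply, e.hom_inv_id, M.map_id]
  rfl

instance : Nonempty (ElementIndex M) := ⟨⟨⟨0, ∅⟩, 0⟩⟩

instance : IsDirectedOrder (ElementIndex M) where
  directed s t := by
    let B : ModuleCat.{u} R := ModuleCat.of R (s.1.mod × t.1.mod)
    let i₁ : s.1.mod ⟶ B := ModuleCat.ofHom (LinearMap.inl R s.1.mod t.1.mod)
    let i₂ : t.1.mod ⟶ B := ModuleCat.ofHom (LinearMap.inr R s.1.mod t.1.mod)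
    let p₁ : B ⟶ s.1.mod := ModuleCat.ofHom (LinearMap.fst R s.1.mod t.1.mod)
    let p₂ : B ⟶ t.1.mod := ModuleCat.ofHom (LinearMap.snd R s.1.mod t.1.mod)
    have h₁₁ : i₁ ≫ p₁ = 𝟙 _ := rfl
    have h₁₂ : i₁ ≫ p₂ = 0 := rfl
    have h₂₁ : i₂ ≫ p₁ = 0 := rfl
    have h₂₂ : i₂ ≫ p₂ = 𝟙 _ := rfl
    -- By additivity, this element of `M` at the product projects to both generators.
    obtain ⟨r, g, hg⟩ := ElementIndex.exists_ge (M := M) B (M.map i₁ s.2 + M.map i₂ t.2)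
    refine ⟨r, ⟨g ≫ p₁, ?_⟩, ⟨g ≫ p₂, ?_⟩⟩
    · rw [functor_map_comp_apply, hg, map_add, ← functor_map_comp_apply, ← functor_map_comp_apply, h₁₁, h₂₁, M.map_id,
        M.map_zero]
      exact add_zero _
    · rw [functor_map_comp_apply, hg, map_add, ← functor_map_comp_apply, ← functor_map_comp_apply, h₁₂, h₂₂, M.map_id,
        M.map_zero]
      exact zero_add _

theorem cyclicAddSubgroup_mono {s t : ElementIndex M} (h : s ≤ t) (S : ModuleCat.{u} R) :
    cyclicAddSubgroup M s.2 S ≤ cyclicAddSubgroup M t.2 S := by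
  obtain ⟨g, hg⟩ := h
  rintro _ ⟨k, rfl⟩
  refine ⟨g ≫ k, ?_⟩
  change M.map (g ≫ k) t.2 = M.map k s.2
  rw [functor_map_comp_apply, hg]

variable (M) in
/-- The direct system of cyclic subfunctors of `M`. -/
def cyclicSystem : ElementIndex M ⥤ ModuleCat.{u} R ⥤ AddCommGrpCat.{u} where
  obj s := cyclicSubfunctor M s.2
  map f := { app S := AddCommGrpCat.ofHom (AddSubgroup.inclusion (cyclicAddSubgroup_mono f.le S)) }

variable (M) in
/-- The inclusions of the cyclic subfunctors of `M`. -/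
def cyclicSystemι : cyclicSystem M ⟶ (Functor.const _).obj M where
  app s := cyclicSubfunctorι M s.2

theorem nonempty_isColimit_cyclicSystem (hM : PreservesDirectLimits M) :
    Nonempty (IsColimit (Cocone.mk M (cyclicSystemι M))) := by
  refine ⟨evaluationJointlyReflectsColimits _ fun S => Classical.choice ?_⟩
  refine isColimit_of_elementwise_addCommGrp _ _ (fun z => ?_) (fun s y hy => ?_)
  · obtain ⟨B, k, b, hB, rfl⟩ := hM.exists_rep S z
    obtain ⟨t, g, rfl⟩ := ElementIndex.exists_ge (M := M) B b
    exact ⟨t, ⟨_, g ≫ k, functor_map_comp_apply _ _ _⟩, rfl⟩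
  · exact ⟨s, 𝟙 s, Subtype.ext hy⟩

end CyclicSubfunctor

/-! ### The three implications. -/

section MainTheorem

variable {R : Type u} [Ring R] {M : ModuleCat.{u} R ⥤ AddCommGrpCat.{u}}

theorem IsSML.isDirectLimitOfDualEpiFP (hM : IsSML M) : IsDirectLimitOfDualEpiFP M := by
  have := hM.isML.additive
  refine ⟨ElementIndex M, inferInstance, inferInstance, inferInstance, cyclicSystem M,
    cyclicSystemι M, nonempty_isColimit_cyclicSystem hM.isML.preservesDirectLimits, fun s => ?_⟩
  have hFP := hM.isML.isFP_cyclicSubfunctor s.2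
  exact ⟨hFP, inferInstanceAs (Mono (cyclicSubfunctorι M s.2)),
    hM.epi_dualMap _ (cyclicSubfunctorι M s.2) inferInstance hFP⟩

theorem exists_comp_eq_of_epi_dualMap {F : ModuleCat.{u} R ⥤ AddCommGrpCat.{u}} (i : F ⟶ M)
    [Epi (dualMap i)] {N : ModuleCat.{u} Rᵐᵒᵖ} (w : F ⟶ (quasiCoherent R).obj N) :
    ∃ v : M ⟶ (quasiCoherent R).obj N, i ≫ v = w := by
  have h := (AddCommGrpCat.epi_iff_surjective ((dualMap i).app N)).1 inferInstance
  obtain ⟨v, hv⟩ := h w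
  exact ⟨v, hv⟩

theorem epi_dualMap_of_exists {F : ModuleCat.{u} R ⥤ AddCommGrpCat.{u}} (i : F ⟶ M)
    (h : ∀ (N : ModuleCat.{u} Rᵐᵒᵖ) (w : F ⟶ (quasiCoherent R).obj N),
      ∃ v : M ⟶ (quasiCoherent R).obj N, i ≫ v = w) : Epi (dualMap i) :=
  have (N : ModuleCat.{u} Rᵐᵒᵖ) : Epi ((dualMap i).app N) :=
    (AddCommGrpCat.epi_iff_surjective _).2 fun w => h N w
  NatTrans.epi_of_epi_app _

theorem IsDirectLimitOfDualEpiFP.embedsInProdFinitelyPresented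
    (hM : IsDirectLimitOfDualEpiFP M) : EmbedsInProdFinitelyPresented M := by
  obtain ⟨I, _, _, _, F, ι, ⟨hc⟩, h⟩ := hM
  choose P w hP hw using fun i => (h i).1.exists_embedding
  have hv : ∀ i, ∃ v : M ⟶ (quasiCoherent R).obj (P i), ι.app i ≫ v = w i := fun i =>
    have := (h i).2.2
    exists_comp_eq_of_epi_dualMap (ι.app i : F.obj i ⟶ M) (w i)
  choose v hv using hv
  have hinj : ∀ S (z : M.obj S), (∀ i, (v i).app S z = 0) → z = 0 := fun S z hz => by
    obtain ⟨i, y, rfl⟩ := exists_rep_addCommGrp _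
      (isColimitOfPreserves ((evaluation _ _).obj S) hc) z
    have hy : (w i).app S y = 0 := by
      rw [← hv i]
      exact hz i
    have hy0 : y = 0 := hw i S y hy
    rw [hy0]
    exact map_zero ((ι.app i).app S).hom
  refine ⟨I, P, Pi.lift v, hP, ⟨fun {G} a b hab => ?_⟩⟩
  ext S x
  refine sub_eq_zero.1 (hinj S _ fun i => ?_)
  have hi : a ≫ v i = b ≫ v i := by
    rw [← Pi.lift_π v i, ← Category.assoc, ← Category.assoc, hab]
  rw [map_sub, sub_eq_zero]
  exact ConcreteCategory.congr_hom (congrArg (fun k : G ⟶ _ => k.app S) hi) x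

instance quasiCoherent_additive : (quasiCoherent R).Additive where
  map_add {N N' f g} := by
    ext S : 2
    ext1
    exact BalancedTensor.hom_ext fun n s => BalancedTensor.add_tmul _ _ _

/-- Evaluation at `S` preserves products, and a monomorphism of functors is pointwise injective. -/
theorem EmbedsInProdFinitelyPresented.exists_jointly_injective
    (hM : EmbedsInProdFinitelyPresented M) : ∃ (J : Type u) (P : J → ModuleCat.{u} Rᵐᵒᵖ)
      (w : ∀ j, M ⟶ (quasiCoherent R).obj (P j)),
      (∀ j, Module.FinitePresentation Rᵐᵒᵖ (P j)) ∧
        ∀ S (z : M.obj S), (∀ j, (w j).app S z = 0) → z = 0 := by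
  obtain ⟨J, P, f, hP, hf⟩ := hM
  refine ⟨J, P, fun j => f ≫ Pi.π _ j, hP, fun S z hz => ?_⟩
  have hinj := (AddCommGrpCat.mono_iff_injective (f.app S)).1 inferInstance
  refine hinj (Eq.trans ?_ (map_zero (f.app S).hom).symm)
  refine Concrete.isLimit_ext _ (isLimitOfPreserves ((evaluation _ _).obj S)
    (limit.isLimit (Discrete.functor fun j => (quasiCoherent R).obj (P j)))) _ _ fun j => ?_
  rw [map_zero]
  exact hz j.as

theorem EmbedsInProdFinitelyPresented.isSML [M.Additive] (hlim : PreservesDirectLimits M)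
    (hM : EmbedsInProdFinitelyPresented M) : IsSML M := by
  classical
  obtain ⟨J, P, w, hP, hw⟩ := hM.exists_jointly_injective
  have hprod : ∀ j {I : Type u} (S : I → ModuleCat.{u} R)
      (t : ((quasiCoherent R).obj (P j)).obj (ModuleCat.of R (∀ i, S i))),
      (∀ i, toProd ((quasiCoherent R).obj (P j)) S t i = 0) → t = 0 := fun j _ S t ht =>
    injective_toProd_quasiCoherent (P j) S t ht
  refine ⟨⟨inferInstance, hlim, fun {I} S x x' hx => ?_⟩, fun F i hi hF => ?_⟩
  · refine sub_eq_zero.1 (hw _ _ fun j => hprod j S _ fun k => ?_)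
    rw [toProd_app]
    have : toProd M S (x - x') k = 0 :=
      (map_sub (M.map _).hom x x').trans (sub_eq_zero.2 (congrFun hx k))
    rw [this, map_zero]
  · have hiinj : ∀ S (z : F.obj S), i.app S z = 0 → z = 0 := fun S z hz =>
      (AddCommGrpCat.mono_iff_injective (i.app S)).1 inferInstance
        (hz.trans (map_zero (i.app S).hom).symm)
    obtain ⟨E, hE⟩ := hF.exists_finset_jointly_injective hprod (fun j => i ≫ w j)
      (fun S z hz => hiinj S z (hw S _ hz))
    let Q : ModuleCat.{u} Rᵐᵒᵖ := ModuleCat.of Rᵐᵒᵖ (∀ j : E, P j)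
    let σ : ∀ j : E, P j ⟶ Q := fun j =>
      ModuleCat.ofHom (LinearMap.single Rᵐᵒᵖ (fun j : E => P j) j)
    let π : ∀ j : E, Q ⟶ P j := fun j =>
      ModuleCat.ofHom (LinearMap.proj j : (∀ j : E, P j) →ₗ[Rᵐᵒᵖ] P j)
    -- Additivity of `quasiCoherent` lets finitely many `w j` be packed into one map, from which the
    -- projections of `Q` recover each of them.
    let W : M ⟶ (quasiCoherent R).obj Q := ∑ j : E, w j ≫ (quasiCoherent R).map (σ j)
    have hWπ : ∀ j, W ≫ (quasiCoherent R).map (π j) = w j := fun j => by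
      have h0 : ∀ k : E, k ≠ j → σ k ≫ π j = 0 := fun k hk => by
        ext x
        exact Pi.single_eq_of_ne (M := fun j : E => P j) (Ne.symm hk) x
      have h1 : σ j ≫ π j = 𝟙 _ := by
        ext x
        exact Pi.single_eq_same (M := fun j : E => P j) j x
      rw [Preadditive.sum_comp, Finset.sum_eq_single j]
      · rw [Category.assoc, ← Functor.map_comp, h1, CategoryTheory.Functor.map_id, Category.comp_id]
      · intro k _ hk
        rw [Category.assoc, ← Functor.map_comp, h0 k hk, Functor.map_zero, comp_zero]
      · simp
    have hWinj : ∀ S (z : F.obj S), (i ≫ W).app S z = 0 → z = 0 := fun S z hz => by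
      refine hE S z fun j hj => ?_
      have : i ≫ w j = (i ≫ W) ≫ (quasiCoherent R).map (π ⟨j, hj⟩) := by
        rw [Category.assoc, hWπ]
      rw [this, NatTrans.comp_app, ConcreteCategory.comp_apply, hz, map_zero]
    have : Module.FinitePresentation Rᵐᵒᵖ Q :=
      inferInstanceAs (Module.FinitePresentation Rᵐᵒᵖ (∀ j : E, P j))
    obtain ⟨A, y, -, hy⟩ := hF.exists_generator
    refine epi_dualMap_of_exists i fun N v => ?_
    obtain ⟨f, hf⟩ := exists_comp_quasiCoherent_map_eq (i ≫ W) hWinj v y hy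
    exact ⟨W ≫ (quasiCoherent R).map f, by rw [← Category.assoc, hf]⟩

end MainTheorem

end FunctorialModules

theorem mainTheorem3 {R : Type u} [Ring R]
    (M : CategoryTheory.Functor (ModuleCat.{u} R) AddCommGrpCat.{u}) (hadd : M.Additive)
    (hlim : FunctorialModules.PreservesDirectLimits M) :
    List.TFAE
      [FunctorialModules.IsSML M,
       FunctorialModules.IsDirectLimitOfDualEpiFP M,
       FunctorialModules.EmbedsInProdFinitelyPresented M] := by
  tfae_have 1 → 2 := fun h => h.isDirectLimitOfDualEpiFP
  tfae_have 2 → 3 := fun h => h.embedsInProdFinitelyPresented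
  tfae_have 3 → 1 := fun h => h.isSML hlim
  tfae_finish
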